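/- Let $\mathcal S_0(\mathbb R)$ be the space of all (complex-valued) Schwartz functions $\varphi$ with $\int_{\mathbb R}x^k\varphi(x)\,dx=0$ for every $k\in\mathbb N_0$, with the topology inherited from $\mathcal S(\mathbb R)$, and let $\mathcal S_0'(\mathbb R)$ be its dual. Let $\varphi\in\mathcal S_0(\mathbb R)$ be an orthonormal wavelet, i.e. the functions $\varphi_{m,n}(x)=2^{m/2}\varphi(2^mx-n)$, $m,n\in\mathbb Z$, form an orthonormal basis of $L^2(\mathbb R)$. Let $L$ be slowly varying at the origin, i.e. a real function, measurable and positive on some interval $(0,A]$ with $A>0$, such that $\lim_{\varepsilon\to0^+}L(a\varepsilon)/L(\varepsilon)=1$ for each $a>0$. Let $f\in\mathcal S_0'(\mathbb R)$ and $x_0,\alpha\in\mathbb R$. For $\varepsilon>0$ let $f(x_0+\varepsilon\,\cdot)\in\mathcal S_0'(\mathbb R)$ be given by $\langle f(x_0+\varepsilon\,\cdot),\psi\rangle=\varepsilon^{-1}\langle f,\psi((\cdot-x_0)/\varepsilon)\rangle$, and put $c^{\varphi}_{m,n}(f;\varepsilon,x_0)=\langle f(x_0+\varepsilon\,\cdot),\overline{\varphi_{m,n}}\rangle$.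 For $\varepsilon_0>0$ consider the conditions (Q) there is $g\in\mathcal S_0'(\mathbb R)$ such that $\displaystyle\lim_{\varepsilon\to0^+}\frac{\langle f(x_0+\varepsilon\,\cdot),\psi\rangle}{\varepsilon^\alpha L(\varepsilon)}=\langle g,\psi\rangle$ for every $\psi\in\mathcal S_0(\mathbb R)$, that is, $f(x_0+\varepsilon x)\sim\varepsilon^\alpha L(\varepsilon)g(x)$ as $\varepsilon\to0^+$ in $\mathcal S_0'(\mathbb R)$; (i) for each $m,n\in\mathbb Z$ the limit $\displaystyle\lim_{\varepsilon\to0^+}\frac{c^{\varphi}_{m,n}(f;\varepsilon,x_0)}{\varepsilon^\alpha L(\varepsilon)}$ exists in $\mathbb C$; (ii)$_{\varepsilon_0}$ there are constants $\beta,\gamma,C>0$ such that $|c^{\varphi}_{m,n}(f;\varepsilon,x_0)|\le C\,\varepsilon^\alpha L(\varepsilon)(1+|n|)^\beta\left(2^m+2^{-m}\right)^\gamma$ for all $m,n\in\mathbb Z$ and $0<\varepsilon\le\varepsilon_0$. Then (Q) holds if and only if (i) holds and (ii)$_{\varepsilon_0}$ holds for some $\varepsilon_0>0$. If, moreover, $L$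 is defined on $(0,1]$ and is bounded below by a positive constant on $[\delta,1]$ for every $\delta\in(0,1]$, then (Q) holds if and only if (i) and (ii)$_1$ hold (the bound for all $0<\varepsilon\le1$). -/

import Mathlib

open MeasureTheory Filter Topology
open scoped SchwartzMap

noncomputable section

namespace Lizorkin

theorem integrable_pow_mul (φ : 𝓢(ℝ, ℂ)) (k : ℕ) :
    Integrable (fun x : ℝ => (x : ℂ) ^ k * φ x) := by
  refine (integrable_norm_iff ?_).1 ?_
  · have := φ.continuous
    exact Continuous.aestronglyMeasurable (by fun_prop)
  · simpa using φ.integrable_pow_mul volume k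

/-- The space `𝒮₀(ℝ)` of Schwartz functions all of whose moments vanish. As a submodule of
`𝒮(ℝ)` it carries the relative topology. -/
def TestSpace : Submodule ℂ 𝓢(ℝ, ℂ) where
  carrier := {φ | ∀ k : ℕ, ∫ x : ℝ, (x : ℂ) ^ k * φ x = 0}
  zero_mem' := by simp
  add_mem' := by
    intro φ ψ hφ hψ k
    simp only [add_apply, mul_add]
    rw [integral_add (integrable_pow_mul φ k) (integrable_pow_mul ψ k), hφ k, hψ k, add_zero]
  smul_mem' := by
    intro c φ hφ k
    simp only [smul_apply, smul_eq_mul, mul_left_comm _ c]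
    rw [integral_const_mul, hφ k, mul_zero]

/-- The space `𝒮₀'(ℝ)` of Lizorkin distributions: continuous linear functionals on `𝒮₀(ℝ)`. -/
abbrev Distrib : Type := TestSpace →L[ℂ] ℂ

/-- The map `φ ↦ φ(a · + b)` on `𝒮(ℝ)`, for `a ≠ 0`. -/
def schwartzAffine (a b : ℝ) (ha : a ≠ 0) : 𝓢(ℝ, ℂ) →L[ℂ] 𝓢(ℝ, ℂ) :=
  SchwartzMap.compCLMOfAntilipschitz ℂ (g := fun x : ℝ => a * x + b) (K := ‖a‖₊⁻¹)
    (by fun_prop) (AntilipschitzWith.of_le_mul_dist fun x y => by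
      have h : a * x + b - (a * y + b) = a * (x - y) := by ring
      have h' : ‖a‖ ≠ 0 := norm_ne_zero_iff.2 ha
      rw [dist_eq_norm, dist_eq_norm, h, norm_mul]
      simp [inv_mul_cancel_left₀ (abs_ne_zero.2 ha)])

@[simp] theorem schwartzAffine_apply (a b : ℝ) (ha : a ≠ 0) (φ : 𝓢(ℝ, ℂ)) (x : ℝ) :
    schwartzAffine a b ha φ x = φ (a * x + b) := rfl

theorem schwartzAffine_mem (a b : ℝ) (ha : a ≠ 0) (φ : TestSpace) :
    schwartzAffine a b ha φ ∈ TestSpace := by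
  intro k
  have key : ∀ x : ℝ, (x : ℂ) ^ k * schwartzAffine a b ha φ x =
      (fun y : ℝ => (((y - b) / a : ℝ) : ℂ) ^ k * (φ : 𝓢(ℝ, ℂ)) y) (a * x + b) := by
    intro x
    simp only [schwartzAffine_apply, add_sub_cancel_right, mul_div_cancel_left₀ _ ha]
  simp_rw [key]
  have h1 := Measure.integral_comp_mul_left
    (fun z : ℝ => (fun y : ℝ => (((y - b) / a : ℝ) : ℂ) ^ k * (φ : 𝓢(ℝ, ℂ)) y) (z + b)) a
  rw [h1, integral_add_right_eq_self
    (fun y : ℝ => (((y - b) / a : ℝ) : ℂ) ^ k * (φ : 𝓢(ℝ, ℂ)) y) b]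
  have h2 : ∀ y : ℝ, (((y - b) / a : ℝ) : ℂ) ^ k * (φ : 𝓢(ℝ, ℂ)) y =
      ∑ j ∈ Finset.range (k + 1), ((a : ℂ)⁻¹ ^ k * (-(b : ℂ)) ^ (k - j) * (k.choose j : ℂ)) *
        ((y : ℂ) ^ j * (φ : 𝓢(ℝ, ℂ)) y) := by
    intro y
    push_cast
    rw [div_eq_mul_inv, mul_pow, sub_eq_add_neg, add_pow, Finset.sum_mul, Finset.sum_mul]
    refine Finset.sum_congr rfl fun j _ => ?_
    ring
  simp_rw [h2]
  rw [integral_finsetSum _ fun j _ => (integrable_pow_mul (φ : 𝓢(ℝ, ℂ)) j).const_mul _]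
  simp only [integral_const_mul, φ.2 _, mul_zero, Finset.sum_const_zero, smul_zero]

/-- The map `φ ↦ φ(a · + b)` on `𝒮₀(ℝ)`, for `a ≠ 0`. -/
def affine (a b : ℝ) (ha : a ≠ 0) : TestSpace →L[ℂ] TestSpace :=
  ((schwartzAffine a b ha).comp TestSpace.subtypeL).codRestrict TestSpace
    (schwartzAffine_mem a b ha)

@[simp] theorem affine_apply (a b : ℝ) (ha : a ≠ 0) (φ : TestSpace) (x : ℝ) :
    (affine a b ha φ : 𝓢(ℝ, ℂ)) x = (φ : 𝓢(ℝ, ℂ)) (a * x + b) := rfl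

/-- The complex conjugate of a function of `𝒮₀(ℝ)`. -/
def conj (φ : TestSpace) : TestSpace :=
  ⟨(φ : 𝓢(ℝ, ℂ)).postcompCLM (Complex.conjCLE : ℂ →L[ℝ] ℂ), by
    intro k
    have h : ∀ x : ℝ, (x : ℂ) ^ k *
        (φ : 𝓢(ℝ, ℂ)).postcompCLM (Complex.conjCLE : ℂ →L[ℝ] ℂ) x =
        (starRingEnd ℂ) ((x : ℂ) ^ k * (φ : 𝓢(ℝ, ℂ)) x) := by
      intro x
      simp
    simp_rw [h]
    rw [integral_conj, φ.2 k, map_zero]⟩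

@[simp] theorem conj_apply (φ : TestSpace) (x : ℝ) :
    (conj φ : 𝓢(ℝ, ℂ)) x = (starRingEnd ℂ) ((φ : 𝓢(ℝ, ℂ)) x) := rfl

/-- `φ_{m,n}(x) = 2^{m/2} φ(2^m x - n)`. -/
def waveletFun (φ : ℝ → ℂ) (m n : ℤ) (x : ℝ) : ℂ :=
  ((2 : ℝ) ^ ((m : ℝ) / 2) : ℝ) * φ ((2 : ℝ) ^ m * x - n)

/-- `φ` is an orthonormal wavelet: the functions `φ_{m,n}`, `m, n ∈ ℤ`, form an orthonormal
(Hilbert) basis of `L²(ℝ)`. -/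
def IsOrthonormalWavelet (φ : ℝ → ℂ) : Prop :=
  ∃ B : HilbertBasis (ℤ × ℤ) ℂ (Lp ℂ 2 (volume : Measure ℝ)),
    ∀ m n : ℤ, (B (m, n) : ℝ → ℂ) =ᵐ[volume] waveletFun φ m n

/-- The function `φ_{m,n}` as an element of `𝒮₀(ℝ)`. -/
def wavelet (φ : TestSpace) (m n : ℤ) : TestSpace :=
  (((2 : ℝ) ^ ((m : ℝ) / 2) : ℝ) : ℂ) •
    affine ((2 : ℝ) ^ m) (-n) (zpow_ne_zero m two_ne_zero) φ

theorem wavelet_apply (φ : TestSpace) (m n : ℤ) (x : ℝ) :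
    (wavelet φ m n : 𝓢(ℝ, ℂ)) x = waveletFun (φ : 𝓢(ℝ, ℂ)) m n x := by
  simp [wavelet, waveletFun, sub_eq_add_neg]

/-- The distribution `f(x₀ + ε ·)`, that is
`⟨f(x₀ + ε ·), φ⟩ = ε⁻¹ ⟨f, φ((· - x₀) / ε)⟩` for `ε > 0` (and the value `0` for `ε ≤ 0`,
which is never used). -/
def dilate (f : Distrib) (x₀ ε : ℝ) : Distrib :=
  if h : 0 < ε then ((ε⁻¹ : ℝ) : ℂ) • f.comp (affine ε⁻¹ (-x₀ / ε) (inv_ne_zero h.ne')) else 0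

/-- The wavelet coefficient `c_{m,n}^φ(f; ε, x₀) = ⟨f(x₀ + ε ·), conj φ_{m,n}⟩`. -/
def waveletCoeff (φ : TestSpace) (f : Distrib) (ε x₀ : ℝ) (m n : ℤ) : ℂ :=
  dilate f x₀ ε (conj (wavelet φ m n))

/-- `L` is slowly varying at the origin: it is (Lebesgue) measurable and positive on some interval
`(0, A]`, and `L(aε) / L(ε) → 1` as `ε → 0⁺` for each `a > 0`. The values of `L` outside
`(0, A]` are irrelevant. -/
def SlowlyVaryingAtZero (L : ℝ → ℝ) : Prop :=
  (∃ A : ℝ, 0 < A ∧ AEMeasurable L (volume.restrict (Set.Ioc 0 A)) ∧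
    ∀ ε ∈ Set.Ioc 0 A, 0 < L ε) ∧
  ∀ a : ℝ, 0 < a → Tendsto (fun ε => L (a * ε) / L ε) (𝓝[>] 0) (𝓝 1)

/-- `f(x₀ + ε x) ∼ ε^α L(ε) g(x)` as `ε → 0⁺` in `𝒮₀'(ℝ)`. -/
def HasQuasiasymptotics (f : Distrib) (x₀ α : ℝ) (L : ℝ → ℝ) (g : Distrib) : Prop :=
  ∀ ψ : TestSpace,
    Tendsto (fun ε : ℝ => dilate f x₀ ε ψ / ((ε ^ α * L ε : ℝ) : ℂ)) (𝓝[>] 0) (𝓝 (g ψ))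

/-- The rescaled wavelet coefficients all have a limit in `ℂ` as `ε → 0⁺`. -/
def CoeffLimitsExist (φ : TestSpace) (f : Distrib) (x₀ α : ℝ) (L : ℝ → ℝ) : Prop :=
  ∀ m n : ℤ, ∃ l : ℂ,
    Tendsto (fun ε : ℝ => waveletCoeff φ f ε x₀ m n / ((ε ^ α * L ε : ℝ) : ℂ)) (𝓝[>] 0) (𝓝 l)

/-- `|c_{m,n}^φ(f; ε, x₀)| ≤ C ε^α L(ε) (1 + |n|)^β (2^m + 2^{-m})^γ` for all `m, n ∈ ℤ` and
`0 < ε ≤ ε₀`, with some positive constants `β`, `γ`, `C`. -/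
def CoeffBound (φ : TestSpace) (f : Distrib) (x₀ α : ℝ) (L : ℝ → ℝ) (ε₀ : ℝ) : Prop :=
  ∃ β γ C : ℝ, 0 < β ∧ 0 < γ ∧ 0 < C ∧ ∀ m n : ℤ, ∀ ε : ℝ, 0 < ε → ε ≤ ε₀ →
    ‖waveletCoeff φ f ε x₀ m n‖ ≤
      C * ε ^ α * L ε * (1 + |(n : ℝ)|) ^ β * ((2 : ℝ) ^ m + 1 / (2 : ℝ) ^ m) ^ γ

end Lizorkin

end

/-! Everything rests on expanding a test function `ψ` in wavelets. Integrating by parts in `𝒮₀(ℝ)`,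
where every function has an antiderivative in the same space, shows that the coefficients of `ψ`
decay faster than any power of `(1 + |n|)(2^m + 2^{-m})`, while the seminorms of `φ_{m,n}` grow only
polynomially in that quantity. The expansion therefore converges in `𝒮(ℝ)`, and its sum is
identified in `L²` (`hasSum_wavelet`). Applying a distribution term by term turns `⟨f(x₀ + ε ·), ψ⟩`
into a series of wavelet coefficients of `f` weighted by those of `ψ`.

Sufficiency (`quasiasymptotics_of_coeff`) is then dominated convergence for this series: the
coefficient limits give termwise convergence and the coefficient bound gives the majorant. The limit
functional is continuous by Banach–Steinhaus.

Necessity: the coefficient limits are the case `ψ = conj φ_{m,n}`. Banach–Steinhaus on the complete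
metrizable space `𝒮₀(ℝ)` gives one seminorm bounding the rescaled distributions for all small `ε`
(`HasQuasiasymptotics.exists_norm_dilate_le`); evaluated on the wavelets, this is the coefficient
bound. On `[δ, 1]` the dilates of `f` are uniformly bounded and `ε^α L(ε)` is bounded below, so the
bound extends to `(0, 1]`. -/

noncomputable section

/-! ### Completeness of the Schwartz space. -/

namespace SchwartzMap

theorem derivCLM_iterate_apply (u : 𝓢(ℝ, ℂ)) (j : ℕ) :
    ((derivCLM ℝ ℂ)^[j] u : ℝ → ℂ) = iteratedDeriv j u := by
  induction j with
  | zero => simp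
  | succ j ih =>
    rw [Function.iterate_succ_apply', iteratedDeriv_succ, ← ih]
    rfl

/-- The `j`-th derivative, as a map into bounded continuous functions. -/
def iteratedDerivBCF (j : ℕ) : 𝓢(ℝ, ℂ) →L[ℝ] BoundedContinuousFunction ℝ ℂ :=
  (toBoundedContinuousFunctionCLM ℝ ℝ ℂ).comp ((derivCLM ℝ ℂ) ^ j)

theorem iteratedDerivBCF_apply (j : ℕ) (u : 𝓢(ℝ, ℂ)) (x : ℝ) :
    iteratedDerivBCF j u x = iteratedDeriv j u x := by
  rw [← derivCLM_iterate_apply, ← FunLike.coe_pow_eq_iterate]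
  rfl

/-- Along a Cauchy sequence all derivatives converge uniformly, so the limits `F j` are successive
derivatives of `F 0`; the weighted Cauchy estimates pass to the pointwise limit. Completeness feeds
both Banach–Steinhaus and the summation of wavelet series. -/
instance : CompleteSpace 𝓢(ℝ, ℂ) := by
  have : (uniformity 𝓢(ℝ, ℂ)).IsCountablyGenerated :=
    IsUniformAddGroup.uniformity_countably_generated
  refine UniformSpace.complete_of_cauchySeq_tendsto fun u hu => ?_
  have hF : ∀ j, ∃ F : BoundedContinuousFunction ℝ ℂ,
      Tendsto (fun n => iteratedDerivBCF j (u n)) atTop (𝓝 F) := fun j =>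
    cauchySeq_tendsto_of_complete ((iteratedDerivBCF j).uniformContinuous.comp_cauchySeq hu)
  choose F hF using hF
  have hunif : ∀ j, TendstoUniformly (fun n => iteratedDeriv j (u n)) (F j) atTop := by
    intro j
    have := BoundedContinuousFunction.tendsto_iff_tendstoUniformly.1 (hF j)
    simpa only [funext (iteratedDerivBCF_apply j _)] using this
  have hpt : ∀ j x, Tendsto (fun n => iteratedDeriv j (u n) x) atTop (𝓝 (F j x)) :=
    fun j x => (hunif j).tendsto_at x
  have hder : ∀ j x, HasDerivAt (F j) (F (j + 1) x) x := by
    intro j x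
    refine hasDerivAt_of_tendstoUniformly (hunif (j + 1))
      (Eventually.of_forall fun n x => ?_) (hpt j) x
    have := (((derivCLM ℝ ℂ)^[j] (u n)).hasDerivAt x)
    rwa [derivCLM_iterate_apply, ← iteratedDeriv_succ] at this
  have hiter : ∀ j, iteratedDeriv j (F 0) = F j := by
    intro j
    induction j with
    | zero => simp
    | succ j ih =>
      rw [iteratedDeriv_succ, ih]
      exact funext fun x => (hder j x).deriv
  have hsmooth : ContDiff ℝ (⊤ : ℕ∞) (F 0) := by
    refine contDiff_of_differentiable_iteratedDeriv fun j _ => ?_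
    rw [hiter]
    exact fun x => (hder j x).differentiableAt
  have hsem : ∀ k j : ℕ, ∀ ε > 0, ∃ N, ∀ n ≥ N, ∀ x : ℝ,
      |x| ^ k * ‖iteratedDeriv j (u n) x - F j x‖ ≤ ε := by
    intro k j ε hε
    have h0 : ∀ᶠ v in 𝓝 (0 : 𝓢(ℝ, ℂ)), SchwartzMap.seminorm ℝ k j v < ε := by
      have hc : Continuous (SchwartzMap.seminorm ℝ k j : 𝓢(ℝ, ℂ) → ℝ) :=
        (schwartz_withSeminorms ℝ ℝ ℂ).continuous_seminorm (k, j)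
      have := hc.tendsto 0
      rw [map_zero] at this
      exact this.eventually_lt_const hε
    have hc := hu.tendsto_uniformity
    rw [uniformity_eq_comap_nhds_zero] at hc
    have hc' := (tendsto_comap_iff.1 hc).eventually h0
    obtain ⟨N, hN⟩ := eventually_atTop_prod_self.1 hc'
    refine ⟨N, fun n hn x => ?_⟩
    have hlim : Tendsto (fun m => |x| ^ k * ‖iteratedDeriv j (u n) x - iteratedDeriv j (u m) x‖)
        atTop (𝓝 (|x| ^ k * ‖iteratedDeriv j (u n) x - F j x‖)) :=
      ((tendsto_const_nhds.sub (hpt j x)).norm).const_mul _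
    refine le_of_tendsto hlim (eventually_atTop.2 ⟨N, fun m hm => ?_⟩)
    have h1 := SchwartzMap.le_seminorm' ℝ k j (u n - u m) x
    have h2 : iteratedDeriv j (u n - u m : 𝓢(ℝ, ℂ)) x =
        iteratedDeriv j (u n) x - iteratedDeriv j (u m) x := by
      simp only [← iteratedDerivBCF_apply, map_sub]
      rfl
    rw [h2] at h1
    exact h1.trans (hN m n hm hn).le
  let v : 𝓢(ℝ, ℂ) :=
    { toFun := F 0
      smooth' := hsmooth
      decay' := by
        intro k j
        obtain ⟨N, hN⟩ := hsem k j 1 one_pos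
        refine ⟨SchwartzMap.seminorm ℝ k j (u N) + 1, fun x => ?_⟩
        rw [norm_iteratedFDeriv_eq_norm_iteratedDeriv, hiter, Real.norm_eq_abs]
        have h1 := SchwartzMap.le_seminorm' ℝ k j (u N) x
        have h2 := hN N le_rfl x
        have h3 : ‖F j x‖ ≤ ‖iteratedDeriv j (u N) x‖ + ‖iteratedDeriv j (u N) x - F j x‖ :=
          norm_le_norm_add_norm_sub _ _
        calc |x| ^ k * ‖F j x‖ ≤ |x| ^ k * (‖iteratedDeriv j (u N) x‖ +
              ‖iteratedDeriv j (u N) x - F j x‖) := by gcongr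
          _ ≤ _ := by rw [mul_add]; exact add_le_add h1 h2 }
  refine ⟨v, ((schwartz_withSeminorms ℝ ℝ ℂ).tendsto_nhds_atTop u v).2 ?_⟩
  rintro ⟨k, j⟩ ε hε
  obtain ⟨N, hN⟩ := hsem k j (ε / 2) (half_pos hε)
  refine ⟨N, fun n hn => lt_of_le_of_lt ?_ (half_lt_self hε)⟩
  refine SchwartzMap.seminorm_le_bound' ℝ k j _ (half_pos hε).le fun x => ?_
  have h2 : iteratedDeriv j (u n - v : 𝓢(ℝ, ℂ)) x =
      iteratedDeriv j (u n) x - iteratedDeriv j v x := by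
    simp only [← iteratedDerivBCF_apply, map_sub]
    rfl
  have h3 : iteratedDeriv j v = F j := hiter j
  rw [h2, h3]
  exact hN n hn x

end SchwartzMap

/-! ### `𝒮₀(ℝ)` as a closed, hence complete and Baire, subspace. -/

namespace Lizorkin

/-- The `k`-th moment of a Schwartz function. -/
def moment (k : ℕ) : 𝓢(ℝ, ℂ) →L[ℂ] ℂ :=
  (SchwartzMap.integralCLM ℂ volume).comp (SchwartzMap.smulLeftCLM ℂ fun x : ℝ => (x : ℂ) ^ k)

theorem moment_apply (k : ℕ) (u : 𝓢(ℝ, ℂ)) : moment k u = ∫ x : ℝ, (x : ℂ) ^ k * u x := by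
  have hg : Function.HasTemperateGrowth fun x : ℝ => (x : ℂ) ^ k := by fun_prop
  simp only [moment, ContinuousLinearMap.comp_apply, SchwartzMap.integralCLM_apply,
    SchwartzMap.smulLeftCLM_apply_apply hg, smul_eq_mul]

theorem isClosed_testSpace : IsClosed (TestSpace : Set 𝓢(ℝ, ℂ)) := by
  have : (TestSpace : Set 𝓢(ℝ, ℂ)) = ⋂ k, {u | moment k u = 0} := by
    ext u
    simp only [moment_apply, Set.mem_iInter]
    rfl
  rw [this]
  exact isClosed_iInter fun k => isClosed_eq (moment k).continuous continuous_const

instance : CompleteSpace TestSpace := isClosed_testSpace.completeSpace_coe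

instance : IsUniformAddGroup TestSpace :=
  inferInstanceAs (IsUniformAddGroup TestSpace.toAddSubgroup)

instance : BaireSpace TestSpace := by
  have : (uniformity 𝓢(ℝ, ℂ)).IsCountablyGenerated :=
    IsUniformAddGroup.uniformity_countably_generated
  have : (uniformity TestSpace).IsCountablyGenerated :=
    inferInstanceAs (comap _ (uniformity 𝓢(ℝ, ℂ))).IsCountablyGenerated
  infer_instance

/-! ### Antiderivatives within `𝒮₀(ℝ)`. -/

theorem integral_Iic_eq_neg_integral_Ioi (u : TestSpace) (x : ℝ) :
    ∫ t in Set.Iic x, (u : 𝓢(ℝ, ℂ)) t = -∫ t in Set.Ioi x, (u : 𝓢(ℝ, ℂ)) t := by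
  have h := integral_add_compl (measurableSet_Iic (a := x)) (u : 𝓢(ℝ, ℂ)).integrable
    (μ := volume)
  have h0 := u.2 0
  simp only [pow_zero, one_mul] at h0
  rw [h0, Set.compl_Iic] at h
  exact eq_neg_of_add_eq_zero_left h

/-- Since the total integral vanishes, one may integrate over whichever side of `x` lies away from
the origin; there `|x| ≤ |t|`, so the weight can be moved inside. -/
theorem abs_pow_mul_norm_integral_le (u : TestSpace) (k : ℕ) (x : ℝ) :
    |x| ^ k * ‖∫ t in Set.Iic x, (u : 𝓢(ℝ, ℂ)) t‖ ≤
      ∫ t, |t| ^ k * ‖(u : 𝓢(ℝ, ℂ)) t‖ := by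
  have hint : Integrable fun t => |t| ^ k * ‖(u : 𝓢(ℝ, ℂ)) t‖ := by
    simpa using (u : 𝓢(ℝ, ℂ)).integrable_pow_mul volume k
  have hS : ∀ S : Set ℝ, MeasurableSet S → (∀ t ∈ S, |x| ≤ |t|) →
      |x| ^ k * ‖∫ t in S, (u : 𝓢(ℝ, ℂ)) t‖ ≤ ∫ t, |t| ^ k * ‖(u : 𝓢(ℝ, ℂ)) t‖ := by
    intro S hSm hSx
    calc |x| ^ k * ‖∫ t in S, (u : 𝓢(ℝ, ℂ)) t‖
        ≤ |x| ^ k * ∫ t in S, ‖(u : 𝓢(ℝ, ℂ)) t‖ := by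
          gcongr
          exact norm_integral_le_integral_norm _
      _ = ∫ t in S, |x| ^ k * ‖(u : 𝓢(ℝ, ℂ)) t‖ := (integral_const_mul _ _).symm
      _ ≤ ∫ t in S, |t| ^ k * ‖(u : 𝓢(ℝ, ℂ)) t‖ := by
          refine setIntegral_mono_on
            ((u : 𝓢(ℝ, ℂ)).integrable.norm.const_mul _).integrableOn hint.integrableOn hSm ?_
          intro t ht
          have := hSx t ht
          gcongr
      _ ≤ _ := setIntegral_le_integral hint (Eventually.of_forall fun t => by positivity)
  rcases le_total x 0 with hx | hx
  · refine hS _ measurableSet_Iic fun t ht => ?_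
    have ht' : t ≤ x := ht
    rw [abs_of_nonpos hx, abs_of_nonpos (ht'.trans hx)]
    linarith
  · rw [integral_Iic_eq_neg_integral_Ioi, norm_neg]
    refine hS _ measurableSet_Ioi fun t ht => ?_
    have ht' : x < t := ht
    rw [abs_of_nonneg hx, abs_of_nonneg (hx.trans ht'.le)]
    exact ht'.le

theorem hasDerivAt_integral_Iic (u : 𝓢(ℝ, ℂ)) (x : ℝ) :
    HasDerivAt (fun x => ∫ t in Set.Iic x, u t) (u x) x := by
  have h : (fun x => ∫ t in Set.Iic x, u t) =
      fun x => (∫ t in Set.Iic 0, u t) + ∫ t in (0 : ℝ)..x, u t := by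
    funext x
    rw [← intervalIntegral.integral_Iic_sub_Iic u.integrable.integrableOn
      u.integrable.integrableOn]
    ring
  rw [h]
  exact (intervalIntegral.integral_hasDerivAt_right
    (u.continuous.intervalIntegrable 0 x)
    (u.continuous.stronglyMeasurableAtFilter _ _) u.continuous.continuousAt).const_add _

theorem iteratedDeriv_integral_Iic (u : 𝓢(ℝ, ℂ)) (j : ℕ) :
    iteratedDeriv (j + 1) (fun x => ∫ t in Set.Iic x, u t) = iteratedDeriv j u := by
  rw [iteratedDeriv_succ']
  congr 1
  exact funext fun x => (hasDerivAt_integral_Iic u x).deriv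

/-- The antiderivative of a function of `𝒮₀(ℝ)` that vanishes at infinity, as a Schwartz
function. -/
def primitive (u : TestSpace) : 𝓢(ℝ, ℂ) where
  toFun x := ∫ t in Set.Iic x, (u : 𝓢(ℝ, ℂ)) t
  smooth' := by
    refine contDiff_of_differentiable_iteratedDeriv fun j _ => ?_
    cases j with
    | zero =>
      rw [iteratedDeriv_zero]
      exact fun x => (hasDerivAt_integral_Iic u x).differentiableAt
    | succ j =>
      rw [iteratedDeriv_integral_Iic, ← SchwartzMap.derivCLM_iterate_apply]
      exact SchwartzMap.differentiable _
  decay' := by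
    intro k j
    simp only [norm_iteratedFDeriv_eq_norm_iteratedDeriv, Real.norm_eq_abs]
    -- Only `j = 0` needs the vanishing integral; higher derivatives are those of `u`.
    cases j with
    | zero => exact ⟨_, fun x => by simpa using abs_pow_mul_norm_integral_le u k x⟩
    | succ j =>
      refine ⟨SchwartzMap.seminorm ℝ k j (u : 𝓢(ℝ, ℂ)), fun x => ?_⟩
      rw [iteratedDeriv_integral_Iic]
      exact SchwartzMap.le_seminorm' ℝ k j (u : 𝓢(ℝ, ℂ)) x

theorem hasDerivAt_primitive (u : TestSpace) (x : ℝ) :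
    HasDerivAt (primitive u) ((u : 𝓢(ℝ, ℂ)) x) x :=
  hasDerivAt_integral_Iic u x

/-- By parts, `∫ x^(k+1) u = -(k+1) ∫ x^k U` for the antiderivative `U`, and the left side is zero.
-/
theorem primitive_mem (u : TestSpace) : primitive u ∈ TestSpace := by
  intro k
  have hd : ∀ x : ℝ, HasDerivAt (fun x : ℝ => (x : ℂ) ^ (k + 1)) ((k + 1 : ℂ) * (x : ℂ) ^ k) x := by
    intro x
    simpa using (Complex.ofRealCLM.hasDerivAt (x := x)).fun_pow (k + 1)
  have h := integral_mul_deriv_eq_deriv_mul_of_integrable (fun x _ => hd x)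
    (fun x _ => hasDerivAt_primitive u x) (integrable_pow_mul u (k + 1))
    (by simpa only [Pi.mul_def, mul_assoc] using
      (integrable_pow_mul (primitive u) k).const_mul (k + 1 : ℂ))
    (integrable_pow_mul (primitive u) (k + 1))
  rw [u.2 (k + 1)] at h
  simp only [mul_assoc] at h
  rw [integral_const_mul, eq_comm, neg_eq_zero, mul_eq_zero] at h
  exact h.resolve_left (by exact_mod_cast k.succ_ne_zero)

theorem exists_derivCLM_eq (u : TestSpace) :
    ∃ U : TestSpace, SchwartzMap.derivCLM ℂ ℂ (U : 𝓢(ℝ, ℂ)) = u :=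
  ⟨⟨primitive u, primitive_mem u⟩, by
    ext x
    exact (hasDerivAt_primitive u x).deriv⟩

/-! ### Rapid decay of the wavelet coefficients of test functions. -/

theorem exists_one_add_abs_pow_mul_le (v : 𝓢(ℝ, ℂ)) (N : ℕ) :
    ∃ C, 0 ≤ C ∧ ∀ x, (1 + |x|) ^ N * ‖v x‖ ≤ C := by
  refine ⟨_, ?_, fun x => by
    simpa using SchwartzMap.one_add_le_sup_seminorm_apply (𝕜 := ℝ) (m := (N, 0)) le_rfl le_rfl v x⟩
  positivity

theorem integrable_one_add_abs_pow_mul (u : 𝓢(ℝ, ℂ)) (N : ℕ) :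
    Integrable fun x => (1 + |x|) ^ N * ‖u x‖ := by
  simp_rw [add_pow, one_pow, one_mul, Finset.sum_mul]
  refine integrable_finsetSum _ fun i _ => ?_
  have := (u.integrable_pow_mul volume (N - i)).const_mul (N.choose i : ℝ)
  refine this.congr (Eventually.of_forall fun x => ?_)
  simp only [Real.norm_eq_abs]
  ring

/-- Writing `u = U'` and integrating by parts moves a derivative onto `v(a · + b)` and gains a
factor `a`. As `U` is again in `𝒮₀(ℝ)`, this can be repeated `M` times. -/
theorem exists_integral_mul_affine_le (M N : ℕ) (u : TestSpace) (v : 𝓢(ℝ, ℂ)) :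
    ∃ C, 0 ≤ C ∧ ∀ a b : ℝ, 0 < a → a ≤ 1 →
      (1 + |b|) ^ N * ‖∫ x, (u : 𝓢(ℝ, ℂ)) x * v (a * x + b)‖ ≤ C * a ^ M := by
  induction M generalizing u v with
  | zero =>
    obtain ⟨C, hC, hv⟩ := exists_one_add_abs_pow_mul_le v N
    have hint := integrable_one_add_abs_pow_mul (u : 𝓢(ℝ, ℂ)) N
    refine ⟨C * ∫ x, (1 + |x|) ^ N * ‖(u : 𝓢(ℝ, ℂ)) x‖, by positivity, fun a b ha ha1 => ?_⟩
    rw [pow_zero, mul_one, ← integral_const_mul]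
    have h1 : (1 + |b|) ^ N * ‖∫ x, (u : 𝓢(ℝ, ℂ)) x * v (a * x + b)‖ =
        ‖∫ x, ((1 + |b|) ^ N : ℝ) • ((u : 𝓢(ℝ, ℂ)) x * v (a * x + b))‖ := by
      rw [integral_smul, norm_smul, Real.norm_of_nonneg (by positivity)]
    rw [h1]
    refine norm_integral_le_of_norm_le (hint.const_mul C) (Eventually.of_forall fun x => ?_)
    rw [norm_smul, Real.norm_of_nonneg (by positivity), norm_mul]
    -- A Peetre-type inequality, using `a ≤ 1`: the weight in `b` is shared between the decay of `u`
    -- and of `v`.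
    have h2 : 1 + |b| ≤ (1 + |x|) * (1 + |a * x + b|) := by
      have h3 : |b| ≤ |a * x + b| + |a * x| := by
        have := abs_sub (a * x + b) (a * x)
        simpa using this
      have h4 : |a * x| ≤ |x| := by
        rw [abs_mul, abs_of_pos ha]
        exact mul_le_of_le_one_left (abs_nonneg _) ha1
      nlinarith [abs_nonneg x, abs_nonneg (a * x + b),
        mul_nonneg (abs_nonneg x) (abs_nonneg (a * x + b))]
    calc (1 + |b|) ^ N * (‖(u : 𝓢(ℝ, ℂ)) x‖ * ‖v (a * x + b)‖)
        ≤ ((1 + |x|) * (1 + |a * x + b|)) ^ N * (‖(u : 𝓢(ℝ, ℂ)) x‖ * ‖v (a * x + b)‖) := by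
          gcongr
      _ = ((1 + |a * x + b|) ^ N * ‖v (a * x + b)‖) * ((1 + |x|) ^ N * ‖(u : 𝓢(ℝ, ℂ)) x‖) := by
          rw [mul_pow]; ring
      _ ≤ _ := by gcongr; exact hv _
  | succ M ih =>
    obtain ⟨U, hU⟩ := exists_derivCLM_eq u
    obtain ⟨C, hC, h⟩ := ih U (SchwartzMap.derivCLM ℂ ℂ v)
    refine ⟨C, hC, fun a b ha ha1 => ?_⟩
    have hd : ∀ x, deriv (schwartzAffine a b ha.ne' v) x =
        (a : ℂ) * SchwartzMap.derivCLM ℂ ℂ v (a * x + b) := by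
      intro x
      have h1 : HasDerivAt (fun x : ℝ => a * x + b) a x := by
        simpa using ((hasDerivAt_id x).const_mul a).add_const b
      have h2 : deriv (schwartzAffine a b ha.ne' v) x = a • deriv v (a * x + b) :=
        ((v.hasDerivAt (a * x + b)).scomp x h1).deriv
      simpa using h2
    have hparts := SchwartzMap.integral_mul_deriv_eq_neg_deriv_mul (U : 𝓢(ℝ, ℂ))
      (schwartzAffine a b ha.ne' v)
    have hu : ∀ x, deriv (U : 𝓢(ℝ, ℂ)) x = (u : 𝓢(ℝ, ℂ)) x := fun x => by
      rw [← hU]; rfl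
    simp only [hd, hu, schwartzAffine_apply, mul_left_comm _ (a : ℂ)] at hparts
    rw [integral_const_mul, eq_neg_iff_add_eq_zero, add_comm, ← eq_neg_iff_add_eq_zero] at hparts
    rw [hparts, norm_neg, norm_mul, Complex.norm_real, Real.norm_of_nonneg ha.le]
    calc _ = a * ((1 + |b|) ^ N * ‖∫ x, (U : 𝓢(ℝ, ℂ)) x *
          SchwartzMap.derivCLM ℂ ℂ v (a * x + b)‖) := by ring
      _ ≤ a * (C * a ^ M) := mul_le_mul_of_nonneg_left (h a b ha ha1) ha.le
      _ = _ := by ring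

theorem one_le_add_inv {a : ℝ} (ha : 0 < a) : 1 ≤ a + a⁻¹ := by
  rcases le_total 1 a with h | h
  · have := inv_pos.2 ha
    linarith
  · have := (one_le_inv₀ ha).2 h
    linarith

/-- For `2^m ≤ 1` the affine estimate applies directly. For `2^m ≥ 1` a change of variables
exchanges `u` and `v` and replaces `2^m` by its inverse, so both functions need vanishing moments.
-/
theorem exists_integral_mul_wavelet_le (N : ℕ) (u v : TestSpace) :
    ∃ C, 0 ≤ C ∧ ∀ m n : ℤ,
      (1 + |(n : ℝ)|) ^ N * ((2 : ℝ) ^ m + ((2 : ℝ) ^ m)⁻¹) ^ N *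
        ‖∫ x, (u : 𝓢(ℝ, ℂ)) x * (wavelet v m n : 𝓢(ℝ, ℂ)) x‖ ≤ C := by
  obtain ⟨C₁, hC₁, h₁⟩ := exists_integral_mul_affine_le N N u (v : 𝓢(ℝ, ℂ))
  -- Of the `2N` powers of `a⁻¹`, half absorb `(a + a⁻¹)^N` and half the loss in `1 + |n| ≤ a(1 +
  -- |a⁻¹ n|)`.
  obtain ⟨C₂, hC₂, h₂⟩ := exists_integral_mul_affine_le (2 * N) N v (u : 𝓢(ℝ, ℂ))
  refine ⟨2 ^ N * C₁ + 2 ^ N * C₂, by positivity, fun m n => ?_⟩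
  set a : ℝ := (2 : ℝ) ^ m with ha_def
  have ha : 0 < a := by positivity
  have hsqrt : (2 : ℝ) ^ ((m : ℝ) / 2) = a ^ (1 / 2 : ℝ) := by
    rw [ha_def, ← Real.rpow_intCast, ← Real.rpow_mul two_pos.le]
    ring_nf
  have hw : ‖∫ x, (u : 𝓢(ℝ, ℂ)) x * (wavelet v m n : 𝓢(ℝ, ℂ)) x‖ =
      a ^ (1 / 2 : ℝ) * ‖∫ x, (u : 𝓢(ℝ, ℂ)) x * (v : 𝓢(ℝ, ℂ)) (a * x + (-n : ℝ))‖ := by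
    simp_rw [wavelet_apply, waveletFun, hsqrt, mul_left_comm _ (((a ^ (1 / 2 : ℝ) : ℝ)) : ℂ)]
    rw [integral_const_mul, norm_mul, Complex.norm_real, Real.norm_of_nonneg (by positivity)]
    simp only [sub_eq_add_neg]
    rfl
  rw [hw]
  rcases le_total a 1 with h | h
  · have hs : a ^ (1 / 2 : ℝ) ≤ 1 := Real.rpow_le_one ha.le h (by norm_num)
    have hb := h₁ a (-n : ℝ) ha h
    rw [abs_neg] at hb
    have hsum : (a + a⁻¹) ≤ 2 * a⁻¹ := by
      have := (one_le_inv₀ ha).2 h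
      linarith
    set I := ‖∫ x, (u : 𝓢(ℝ, ℂ)) x * (v : 𝓢(ℝ, ℂ)) (a * x + (-n : ℝ))‖
    have hI : 0 ≤ I := norm_nonneg _
    calc (1 + |(n : ℝ)|) ^ N * (a + a⁻¹) ^ N * (a ^ (1 / 2 : ℝ) * I)
        ≤ (1 + |(n : ℝ)|) ^ N * (2 * a⁻¹) ^ N * (1 * I) := by gcongr
      _ = (2 * a⁻¹) ^ N * ((1 + |(n : ℝ)|) ^ N * I) := by ring
      _ ≤ (2 * a⁻¹) ^ N * (C₁ * a ^ N) := by gcongr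
      _ = 2 ^ N * C₁ * (a⁻¹ * a) ^ N := by rw [mul_pow, mul_pow]; ring
      _ = 2 ^ N * C₁ := by rw [inv_mul_cancel₀ ha.ne', one_pow, mul_one]
      _ ≤ _ := by linarith [show 0 ≤ 2 ^ N * C₂ by positivity]
  · have hi : a⁻¹ ≤ 1 := inv_le_one_of_one_le₀ h
    have hi0 : 0 < a⁻¹ := inv_pos.2 ha
    have hsub : ∫ x, (u : 𝓢(ℝ, ℂ)) x * (v : 𝓢(ℝ, ℂ)) (a * x + (-n : ℝ)) =
        (a⁻¹ : ℝ) • ∫ y, (v : 𝓢(ℝ, ℂ)) y * (u : 𝓢(ℝ, ℂ)) (a⁻¹ * y + a⁻¹ * n) := by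
      have e1 := Measure.integral_comp_mul_left (fun y => (v : 𝓢(ℝ, ℂ)) (y + (-n : ℝ)) *
        (u : 𝓢(ℝ, ℂ)) (a⁻¹ * y)) a
      have e2 := integral_add_right_eq_self (μ := volume) (fun y => (v : 𝓢(ℝ, ℂ)) y *
        (u : 𝓢(ℝ, ℂ)) (a⁻¹ * y + a⁻¹ * n)) (-n : ℝ)
      rw [abs_of_pos hi0] at e1
      rw [← e2]
      have e3 : ∀ y : ℝ, a⁻¹ * (y + -n) + a⁻¹ * n = a⁻¹ * y := fun y => by ring
      simp_rw [e3]
      rw [← e1]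
      simp_rw [inv_mul_cancel_left₀ ha.ne', mul_comm ((u : 𝓢(ℝ, ℂ)) _)]
    rw [hsub, norm_smul, Real.norm_of_nonneg hi0.le]
    have hs : a ^ (1 / 2 : ℝ) * a⁻¹ ≤ 1 := by
      have : a ^ (1 / 2 : ℝ) ≤ a := by
        conv_rhs => rw [← Real.rpow_one a]
        exact Real.rpow_le_rpow_of_exponent_le h (by norm_num)
      calc a ^ (1 / 2 : ℝ) * a⁻¹ ≤ a * a⁻¹ := by gcongr
        _ = 1 := mul_inv_cancel₀ ha.ne'
    have hb := h₂ a⁻¹ (a⁻¹ * n) hi0 hi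
    set I := ‖∫ y, (v : 𝓢(ℝ, ℂ)) y * (u : 𝓢(ℝ, ℂ)) (a⁻¹ * y + a⁻¹ * n)‖
    have hI : 0 ≤ I := norm_nonneg _
    have hn : 1 + |(n : ℝ)| ≤ a * (1 + |a⁻¹ * n|) := by
      rw [abs_mul, abs_of_pos hi0, mul_add, mul_inv_cancel_left₀ ha.ne', mul_one]
      linarith
    calc (1 + |(n : ℝ)|) ^ N * (a + a⁻¹) ^ N * (a ^ (1 / 2 : ℝ) * (a⁻¹ * I))
        = (1 + |(n : ℝ)|) ^ N * (a + a⁻¹) ^ N * ((a ^ (1 / 2 : ℝ) * a⁻¹) * I) := by ring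
      _ ≤ (a * (1 + |a⁻¹ * n|)) ^ N * (2 * a) ^ N * (1 * I) := by
          gcongr
          linarith
      _ = 2 ^ N * a ^ (2 * N) * ((1 + |a⁻¹ * n|) ^ N * I) := by
          rw [mul_pow, mul_pow, two_mul N, pow_add]; ring
      _ ≤ 2 ^ N * a ^ (2 * N) * (C₂ * a⁻¹ ^ (2 * N)) := by gcongr
      _ = 2 ^ N * C₂ * (a * a⁻¹) ^ (2 * N) := by rw [mul_pow]; ring
      _ = 2 ^ N * C₂ := by rw [mul_inv_cancel₀ ha.ne', one_pow, mul_one]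
      _ ≤ _ := by linarith [show 0 ≤ 2 ^ N * C₁ by positivity]

/-! ### Polynomial growth of seminorms under affine maps. -/

/-- The supremum of the Schwartz seminorms with both indices at most `N`. -/
def supSeminorm (N : ℕ) : Seminorm ℂ 𝓢(ℝ, ℂ) :=
  (Finset.Iic (N, N)).sup (schwartzSeminormFamily ℂ ℝ ℂ)

theorem supSeminorm_mono {M N : ℕ} (h : M ≤ N) (u : 𝓢(ℝ, ℂ)) :
    supSeminorm M u ≤ supSeminorm N u :=
  Seminorm.le_def.1 (Finset.sup_mono (Finset.Iic_subset_Iic.2 (Prod.mk_le_mk.2 ⟨h, h⟩))) u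

theorem finset_sup_le_supSeminorm (s : Finset (ℕ × ℕ)) :
    ∃ N, ∀ u, s.sup (schwartzSeminormFamily ℂ ℝ ℂ) u ≤ supSeminorm N u := by
  refine ⟨s.sup fun i => max i.1 i.2, fun u => Seminorm.le_def.1 (Finset.sup_mono ?_) u⟩
  intro i hi
  have : max i.1 i.2 ≤ s.sup fun i => max i.1 i.2 := Finset.le_sup (f := fun i => max i.1 i.2) hi
  exact Finset.mem_Iic.2 (Prod.mk_le_mk.2 ⟨(le_max_left _ _).trans this,
    (le_max_right _ _).trans this⟩)

theorem iteratedDeriv_schwartzAffine (a b : ℝ) (ha : a ≠ 0) (u : 𝓢(ℝ, ℂ)) (j : ℕ) (x : ℝ) :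
    iteratedDeriv j (schwartzAffine a b ha u) x = a ^ j • iteratedDeriv j u (a * x + b) := by
  have h1 : (schwartzAffine a b ha u : ℝ → ℂ) = fun x => (fun z => u (z + b)) (a * x) := rfl
  have h2 : ContDiff ℝ j fun z => u (z + b) :=
    (u.smooth (j : ℕ∞)).comp (contDiff_id.add contDiff_const)
  rw [h1, iteratedDeriv_comp_const_smul h2, iteratedDeriv_comp_add_const]

theorem supSeminorm_schwartzAffine_le (N : ℕ) (a b : ℝ) (ha : 0 < a) (u : 𝓢(ℝ, ℂ)) :
    supSeminorm N (schwartzAffine a b ha.ne' u) ≤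
      (2 * (a + a⁻¹) ^ 2 * (1 + |b|)) ^ N * supSeminorm N u := by
  have hi : 0 < a⁻¹ := inv_pos.2 ha
  have h1 := one_le_add_inv ha
  refine Seminorm.finset_sup_apply_le (by positivity) ?_
  rintro ⟨k, j⟩ hkj
  obtain ⟨hk, hj⟩ := Prod.mk_le_mk.1 (Finset.mem_Iic.1 hkj)
  refine SchwartzMap.seminorm_le_bound' ℂ k j _ (by positivity) fun x => ?_
  rw [iteratedDeriv_schwartzAffine, norm_smul, norm_pow, Real.norm_of_nonneg ha.le]
  set y := a * x + b with hy
  have hx : |x| ≤ a⁻¹ * ((1 + |b|) * (1 + |y|)) := by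
    have : x = a⁻¹ * (y - b) := by rw [hy]; field_simp; ring
    rw [this, abs_mul, abs_of_pos hi]
    gcongr
    refine (abs_sub _ _).trans ?_
    nlinarith [abs_nonneg b, abs_nonneg y, mul_nonneg (abs_nonneg b) (abs_nonneg y)]
  have hQ : (1 + |y|) ^ k * ‖iteratedDeriv j u y‖ ≤ 2 ^ N * supSeminorm N u := by
    have := SchwartzMap.one_add_le_sup_seminorm_apply (𝕜 := ℂ) (m := (N, N)) hk hj u y
    rw [norm_iteratedFDeriv_eq_norm_iteratedDeriv, Real.norm_eq_abs] at this
    exact this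
  have hb1 : 1 ≤ 1 + |b| := by linarith [abs_nonneg b]
  calc |x| ^ k * (a ^ j * ‖iteratedDeriv j u y‖)
      ≤ (a⁻¹ * ((1 + |b|) * (1 + |y|))) ^ k * (a ^ j * ‖iteratedDeriv j u y‖) := by gcongr
    _ = a⁻¹ ^ k * a ^ j * (1 + |b|) ^ k * ((1 + |y|) ^ k * ‖iteratedDeriv j u y‖) := by
        rw [mul_pow, mul_pow]; ring
    _ ≤ (a + a⁻¹) ^ N * (a + a⁻¹) ^ N * (1 + |b|) ^ N * (2 ^ N * supSeminorm N u) := by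
        gcongr ?_ * ?_ * ?_ * ?_
        · exact (pow_le_pow_left₀ hi.le (by linarith) k).trans (pow_le_pow_right₀ h1 hk)
        · exact (pow_le_pow_left₀ ha.le (by linarith) j).trans (pow_le_pow_right₀ h1 hj)
        · exact pow_le_pow_right₀ hb1 hk
    _ = _ := by rw [mul_pow, mul_pow, ← pow_mul, two_mul N, pow_add]; ring

theorem supSeminorm_wavelet_le (N : ℕ) (u : TestSpace) (m n : ℤ) :
    supSeminorm N (wavelet u m n : 𝓢(ℝ, ℂ)) ≤
      2 ^ N * supSeminorm N (u : 𝓢(ℝ, ℂ)) * (1 + |(n : ℝ)|) ^ N *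
        ((2 : ℝ) ^ m + ((2 : ℝ) ^ m)⁻¹) ^ (2 * N + 1) := by
  have ha : (0 : ℝ) < 2 ^ m := by positivity
  have h0 : (wavelet u m n : 𝓢(ℝ, ℂ)) = (((2 : ℝ) ^ ((m : ℝ) / 2) : ℝ) : ℂ) •
    schwartzAffine ((2 : ℝ) ^ m) (-n) ha.ne' (u : 𝓢(ℝ, ℂ)) := rfl
  rw [h0, map_smul_eq_mul, Complex.norm_real, Real.norm_of_nonneg (by positivity)]
  have hs : (2 : ℝ) ^ ((m : ℝ) / 2) ≤ (2 : ℝ) ^ m + ((2 : ℝ) ^ m)⁻¹ := by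
    rcases le_total 0 m with hm | hm
    · refine le_trans ?_ (le_add_of_nonneg_right (inv_pos.2 ha).le)
      rw [← Real.rpow_intCast]
      have : (0 : ℝ) ≤ m := by exact_mod_cast hm
      exact Real.rpow_le_rpow_of_exponent_le one_le_two (by linarith)
    · refine le_trans ?_ (one_le_add_inv ha)
      have : (m : ℝ) ≤ 0 := by exact_mod_cast hm
      exact Real.rpow_le_one_of_one_le_of_nonpos one_le_two (by linarith)
  have h1 := supSeminorm_schwartzAffine_le N _ (-n) ha (u : 𝓢(ℝ, ℂ))
  rw [abs_neg] at h1
  calc _ ≤ ((2 : ℝ) ^ m + ((2 : ℝ) ^ m)⁻¹) * _ := mul_le_mul hs h1 (apply_nonneg _ _) (by positivity)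
    _ = _ := by rw [mul_pow, mul_pow, ← pow_mul]; ring

/-! ### Uniform boundedness on `𝒮₀(ℝ)`. -/

theorem exists_le_supSeminorm_of_continuous (p : Seminorm ℂ TestSpace) (hp : Continuous p) :
    ∃ (N : ℕ) (C : ℝ), 0 ≤ C ∧ ∀ ψ : TestSpace, p ψ ≤ C * supSeminorm N (ψ : 𝓢(ℝ, ℂ)) := by
  obtain ⟨s, C, -, h⟩ := Seminorm.bound_comp_of_isInducing hp (schwartz_withSeminorms ℂ ℝ ℂ)
    (f := TestSpace.subtype) Topology.IsInducing.subtypeVal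
  obtain ⟨N, hN⟩ := finset_sup_le_supSeminorm s
  exact ⟨N, C, C.2, fun ψ => (h ψ).trans (mul_le_mul_of_nonneg_left (hN _) C.2)⟩

/-- A pointwise bounded family of Lizorkin distributions is dominated by a single seminorm. -/
theorem exists_forall_norm_apply_le_supSeminorm {ι : Type*} (T : ι → Distrib)
    (hT : ∀ ψ, BddAbove (Set.range fun i => ‖T i ψ‖)) :
    ∃ (N : ℕ) (C : ℝ), 0 ≤ C ∧ ∀ i, ∀ ψ : TestSpace,
      ‖T i ψ‖ ≤ C * supSeminorm N (ψ : 𝓢(ℝ, ℂ)) := by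
  -- The Baire property of `TestSpace` enters here: pointwise boundedness yields equicontinuity,
  -- hence one dominating continuous seminorm.
  have h := (norm_withSeminorms ℂ ℂ).banach_steinhaus (𝓕 := T) (fun _ ψ => hT ψ)
  obtain ⟨p, hp, hle⟩ :=
    ((norm_withSeminorms ℂ ℂ).uniformEquicontinuous_iff_exists_continuous_seminorm
      (fun i => (T i).toLinearMap)).1 h 0
  obtain ⟨N, C, hC, hpC⟩ := exists_le_supSeminorm_of_continuous p hp
  exact ⟨N, C, hC, fun i ψ => (hle i ψ).trans (hpC ψ)⟩

theorem exists_norm_apply_le_supSeminorm (f : Distrib) :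
    ∃ (N : ℕ) (C : ℝ), 0 ≤ C ∧ ∀ ψ : TestSpace, ‖f ψ‖ ≤ C * supSeminorm N (ψ : 𝓢(ℝ, ℂ)) := by
  obtain ⟨N, C, hC, h⟩ := exists_forall_norm_apply_le_supSeminorm (fun _ : Unit => f)
    fun ψ => (Set.finite_range _).bddAbove
  exact ⟨N, C, hC, h ()⟩

/-! ### Convergence of the wavelet expansion. -/

theorem summable_int_inv_one_add_sq : Summable fun n : ℤ => ((1 + |(n : ℝ)|) ^ 2)⁻¹ := by
  have h : Summable fun n : ℕ => ((1 + (n : ℝ)) ^ 2)⁻¹ := by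
    have := (summable_nat_add_iff 1).2 (Real.summable_nat_pow_inv.2 (one_lt_two : 1 < 2))
    simpa [add_comm] using this
  refine Summable.of_nat_of_neg ?_ ?_ <;> simpa using h

theorem summable_int_inv_two_zpow_add_inv :
    Summable fun m : ℤ => ((2 : ℝ) ^ m + ((2 : ℝ) ^ m)⁻¹)⁻¹ := by
  have h : Summable fun m : ℕ => ((2 : ℝ) ^ m + ((2 : ℝ) ^ m)⁻¹)⁻¹ := by
    refine Summable.of_nonneg_of_le (fun m => by positivity) (fun m => ?_)
      summable_geometric_two
    rw [one_div, inv_pow]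
    gcongr
    exact le_add_of_nonneg_right (by positivity)
  refine Summable.of_nat_of_neg ?_ ?_
  · simpa using h
  · simpa [add_comm] using h

theorem summable_weight :
    Summable fun p : ℤ × ℤ => ((1 + |(p.2 : ℝ)|) ^ 2 * ((2 : ℝ) ^ p.1 + ((2 : ℝ) ^ p.1)⁻¹))⁻¹ := by
  have := summable_int_inv_two_zpow_add_inv.mul_of_nonneg summable_int_inv_one_add_sq
    (fun m => by positivity) (fun n => by positivity)
  refine this.congr fun p => ?_
  rw [mul_inv, mul_comm]

/-- The wavelet coefficients of a test function decay rapidly. -/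
theorem summable_coeff_mul_weight (N : ℕ) (u v : TestSpace) :
    Summable fun p : ℤ × ℤ => ‖∫ x, (u : 𝓢(ℝ, ℂ)) x * (wavelet v p.1 p.2 : 𝓢(ℝ, ℂ)) x‖ *
      ((1 + |(p.2 : ℝ)|) ^ N * ((2 : ℝ) ^ p.1 + ((2 : ℝ) ^ p.1)⁻¹) ^ N) := by
  -- The two extra powers pay for the summable weight.
  obtain ⟨C, hC, h⟩ := exists_integral_mul_wavelet_le (N + 2) u v
  refine Summable.of_nonneg_of_le (fun p => by positivity) (fun p => ?_)
    (summable_weight.mul_left C)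
  set t := ‖∫ x, (u : 𝓢(ℝ, ℂ)) x * (wavelet v p.1 p.2 : 𝓢(ℝ, ℂ)) x‖ with ht
  have hp := h p.1 p.2
  rw [← ht] at hp
  have h1 := one_le_add_inv (show (0 : ℝ) < 2 ^ p.1 by positivity)
  set A := (2 : ℝ) ^ p.1 + ((2 : ℝ) ^ p.1)⁻¹
  rw [← div_eq_mul_inv, le_div_iff₀ (by positivity)]
  calc t * ((1 + |(p.2 : ℝ)|) ^ N * A ^ N) * ((1 + |(p.2 : ℝ)|) ^ 2 * A)
      = (1 + |(p.2 : ℝ)|) ^ (N + 2) * (A ^ N * A) * t := by ring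
    _ ≤ (1 + |(p.2 : ℝ)|) ^ (N + 2) * (A ^ N * A ^ 2) * t := by
        gcongr
        exact le_self_pow₀ h1 two_ne_zero
    _ ≤ C := by rw [← pow_add]; exact hp

/-- By completeness it suffices that finite sums far out are small, and each neighbourhood of `0` is
controlled by one `supSeminorm N`. -/
theorem summable_of_summable_supSeminorm {ι : Type*} (u : ι → 𝓢(ℝ, ℂ))
    (hu : ∀ N, Summable fun i => supSeminorm N (u i)) : Summable u := by
  rw [summable_iff_vanishing]
  intro e he
  obtain ⟨s, r, hr, hsub⟩ := ((schwartz_withSeminorms ℂ ℝ ℂ).mem_nhds_iff 0 e).1 he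
  obtain ⟨N, hN⟩ := finset_sup_le_supSeminorm s
  obtain ⟨F, hF⟩ := summable_iff_vanishing.1 (hu N) (Set.Iio r) (Iio_mem_nhds hr)
  refine ⟨F, fun t ht => hsub ?_⟩
  rw [Seminorm.mem_ball_zero]
  refine lt_of_le_of_lt ((hN _).trans ?_) (hF t ht)
  exact Finset.le_sum_of_subadditive _ (map_zero _).le (map_add_le_add _) t u

theorem conj_wavelet (φ : TestSpace) (m n : ℤ) :
    conj (wavelet φ m n) = wavelet (conj φ) m n := by
  ext x
  simp [wavelet_apply, waveletFun]

theorem summable_coeff_smul_wavelet (u v w : TestSpace) :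
    Summable fun p : ℤ × ℤ => (∫ x, (u : 𝓢(ℝ, ℂ)) x * (wavelet v p.1 p.2 : 𝓢(ℝ, ℂ)) x) •
      (wavelet w p.1 p.2 : 𝓢(ℝ, ℂ)) := by
  refine summable_of_summable_supSeminorm _ fun N => ?_
  refine Summable.of_nonneg_of_le (fun p => apply_nonneg _ _) (fun p => ?_)
    ((summable_coeff_mul_weight (2 * N + 1) u v).mul_left (2 ^ N * supSeminorm N (w : 𝓢(ℝ, ℂ))))
  rw [map_smul_eq_mul]
  have h1 : (1 : ℝ) ≤ 1 + |(p.2 : ℝ)| := by linarith [abs_nonneg (p.2 : ℝ)]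
  have h2 := one_le_add_inv (show (0 : ℝ) < 2 ^ p.1 by positivity)
  have hq : 0 ≤ supSeminorm N (w : 𝓢(ℝ, ℂ)) := apply_nonneg _ _
  calc _ ≤ ‖∫ x, (u : 𝓢(ℝ, ℂ)) x * (wavelet v p.1 p.2 : 𝓢(ℝ, ℂ)) x‖ *
        (2 ^ N * supSeminorm N (w : 𝓢(ℝ, ℂ)) * (1 + |(p.2 : ℝ)|) ^ N *
        ((2 : ℝ) ^ p.1 + ((2 : ℝ) ^ p.1)⁻¹) ^ (2 * N + 1)) := by
        gcongr
        exact supSeminorm_wavelet_le N w p.1 p.2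
    _ ≤ ‖∫ x, (u : 𝓢(ℝ, ℂ)) x * (wavelet v p.1 p.2 : 𝓢(ℝ, ℂ)) x‖ *
        (2 ^ N * supSeminorm N (w : 𝓢(ℝ, ℂ)) * (1 + |(p.2 : ℝ)|) ^ (2 * N + 1) *
        ((2 : ℝ) ^ p.1 + ((2 : ℝ) ^ p.1)⁻¹) ^ (2 * N + 1)) := by
        gcongr ?_ * (?_ * ?_ * ?_)
        exact pow_le_pow_right₀ h1 (by omega)
    _ = _ := by ring

/-- The wavelet expansion of a test function converges in `𝒮(ℝ)`. -/
theorem hasSum_wavelet {φ : TestSpace} (hφ : IsOrthonormalWavelet (φ : 𝓢(ℝ, ℂ)))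
    (η : TestSpace) :
    HasSum (fun p : ℤ × ℤ => (∫ x, (η : 𝓢(ℝ, ℂ)) x * (wavelet (conj φ) p.1 p.2 : 𝓢(ℝ, ℂ)) x) •
      (wavelet φ p.1 p.2 : 𝓢(ℝ, ℂ))) (η : 𝓢(ℝ, ℂ)) := by
  obtain ⟨s, hs⟩ := summable_coeff_smul_wavelet η (conj φ) φ
  obtain ⟨B, hB⟩ := hφ
  have hB' : ∀ p : ℤ × ℤ, B p = (wavelet φ p.1 p.2 : 𝓢(ℝ, ℂ)).toLp 2 volume := by
    rintro ⟨m, n⟩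
    refine Lp.ext ((hB m n).trans ?_)
    refine EventuallyEq.trans ?_ (SchwartzMap.coeFn_toLp _ 2 volume).symm
    exact Eventually.of_forall fun x => (wavelet_apply φ m n x).symm
  have hmap := (SchwartzMap.toLpCLM ℂ ℂ 2 (volume : Measure ℝ)).hasSum hs
  have hrepr := B.hasSum_repr ((η : 𝓢(ℝ, ℂ)).toLp 2 volume)
  have hcoeff : ∀ p : ℤ × ℤ, B.repr ((η : 𝓢(ℝ, ℂ)).toLp 2 volume) p =
      ∫ x, (η : 𝓢(ℝ, ℂ)) x * (wavelet (conj φ) p.1 p.2 : 𝓢(ℝ, ℂ)) x := by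
    intro p
    rw [B.repr_apply_apply, hB', L2.inner_def]
    refine integral_congr_ae ?_
    filter_upwards [SchwartzMap.coeFn_toLp (η : 𝓢(ℝ, ℂ)) 2 volume,
      SchwartzMap.coeFn_toLp (wavelet φ p.1 p.2 : 𝓢(ℝ, ℂ)) 2 volume] with x h1 h2
    rw [h1, h2, ← conj_wavelet, conj_apply]
    simp
  -- The sum `s` in `𝒮(ℝ)` is also the `L²` sum, which is the Hilbert basis expansion of `η`; the
  -- embedding into `L²` is injective.
  have hs' : s = η := by
    refine SchwartzMap.injective_toLp 2 volume (hmap.unique ?_)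
    convert hrepr using 2 with p
    rw [hcoeff, hB', map_smul]
    rfl
  rwa [hs'] at hs

/-- The conjugate of the expansion of `conj ψ`. The coefficients of `f` pair with conjugated
wavelets, so this is the form needed. -/
theorem hasSum_conj_wavelet {φ : TestSpace} (hφ : IsOrthonormalWavelet (φ : 𝓢(ℝ, ℂ)))
    (ψ : TestSpace) :
    HasSum (fun p : ℤ × ℤ => (∫ x, (ψ : 𝓢(ℝ, ℂ)) x * (wavelet φ p.1 p.2 : 𝓢(ℝ, ℂ)) x) •
      conj (wavelet φ p.1 p.2)) ψ := by
  have h := (SchwartzMap.postcompCLM (E := ℝ) (Complex.conjCLE : ℂ →L[ℝ] ℂ)).hasSum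
    (hasSum_wavelet hφ (conj ψ))
  rw [← Topology.IsInducing.subtypeVal.hasSum_iff (g := TestSpace.subtype)]
  convert h using 2 with p
  · ext x
    simp only [Function.comp_apply, SchwartzMap.postcompCLM_apply, smul_apply,
      smul_eq_mul, ContinuousLinearEquiv.coe_coe, Complex.conjCLE_apply, map_mul, ← integral_conj,
      ← conj_wavelet, conj_apply, Complex.conj_conj]
    rfl
  · ext x
    simp

theorem hasSum_apply_conj_wavelet {φ : TestSpace} (hφ : IsOrthonormalWavelet (φ : 𝓢(ℝ, ℂ)))
    (T : Distrib) (ψ : TestSpace) :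
    HasSum (fun p : ℤ × ℤ => (∫ x, (ψ : 𝓢(ℝ, ℂ)) x * (wavelet φ p.1 p.2 : 𝓢(ℝ, ℂ)) x) *
      T (conj (wavelet φ p.1 p.2))) (T ψ) := by
  simpa [Function.comp_def] using T.hasSum (hasSum_conj_wavelet hφ ψ)

/-! ### From quasiasymptotics to coefficient bounds. -/

theorem SlowlyVaryingAtZero.exists_forall_pos {L : ℝ → ℝ} (hL : SlowlyVaryingAtZero L) :
    ∃ A > 0, ∀ ε, 0 < ε → ε ≤ A → 0 < L ε := by
  obtain ⟨⟨A, hA, -, h⟩, -⟩ := hL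
  exact ⟨A, hA, fun ε h0 h1 => h ε ⟨h0, h1⟩⟩

theorem coeffBound_of_norm_dilate_le (φ : TestSpace) (f : Distrib) (x₀ α : ℝ) (L : ℝ → ℝ)
    (ε₀ : ℝ) (N : ℕ) (C : ℝ) (hC : 0 ≤ C) (hL : ∀ ε, 0 < ε → ε ≤ ε₀ → 0 ≤ L ε)
    (h : ∀ ε, 0 < ε → ε ≤ ε₀ → ∀ ψ : TestSpace,
      ‖dilate f x₀ ε ψ‖ ≤ C * (ε ^ α * L ε) * supSeminorm N (ψ : 𝓢(ℝ, ℂ))) :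
    CoeffBound φ f x₀ α L ε₀ := by
  have hq : 0 ≤ supSeminorm N (conj φ : 𝓢(ℝ, ℂ)) := apply_nonneg _ _
  -- The added `1` in the first exponent and in the constant keeps them strictly positive even if
  -- `N` or `C` is zero.
  refine ⟨((N + 1 : ℕ) : ℝ), ((2 * N + 1 : ℕ) : ℝ),
    C * (2 ^ N * supSeminorm N (conj φ : 𝓢(ℝ, ℂ))) + 1, by positivity, by positivity,
    by positivity, fun m n ε h0 h1 => ?_⟩
  have hLε := hL ε h0 h1
  rw [Real.rpow_natCast, Real.rpow_natCast, one_div, waveletCoeff, conj_wavelet]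
  refine (h ε h0 h1 _).trans ?_
  have hn : (1 : ℝ) ≤ 1 + |(n : ℝ)| := by linarith [abs_nonneg (n : ℝ)]
  calc C * (ε ^ α * L ε) * supSeminorm N (wavelet (conj φ) m n : 𝓢(ℝ, ℂ))
      ≤ C * (ε ^ α * L ε) * (2 ^ N * supSeminorm N (conj φ : 𝓢(ℝ, ℂ)) *
        (1 + |(n : ℝ)|) ^ N * ((2 : ℝ) ^ m + ((2 : ℝ) ^ m)⁻¹) ^ (2 * N + 1)) := by
        gcongr
        exact supSeminorm_wavelet_le N (conj φ) m n
    _ = C * (2 ^ N * supSeminorm N (conj φ : 𝓢(ℝ, ℂ))) * ε ^ α * L ε *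
        (1 + |(n : ℝ)|) ^ N * ((2 : ℝ) ^ m + ((2 : ℝ) ^ m)⁻¹) ^ (2 * N + 1) := by ring
    _ ≤ _ := by
        gcongr ?_ * _ * _ * ?_ * _
        · linarith
        · exact pow_le_pow_right₀ hn N.le_succ

/-- Convergence bounds the quotients only for `ε` small depending on `ψ`, so Banach–Steinhaus is
applied along a sequence, where convergence gives boundedness over all indices. If the claim failed,
there would be `ε_k → 0` and `ψ_k` violating the bound with constant and seminorm index both `k`;
the bound along `ε_k` contradicts this for large `k`. -/
theorem HasQuasiasymptotics.exists_norm_dilate_le {f : Distrib} {x₀ α : ℝ} {L : ℝ → ℝ}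
    {g : Distrib} (h : HasQuasiasymptotics f x₀ α L g) (hL : SlowlyVaryingAtZero L) :
    ∃ ε₀ > 0, ∃ (N : ℕ) (C : ℝ), 0 ≤ C ∧ ∀ ε, 0 < ε → ε ≤ ε₀ → 0 < L ε ∧
      ∀ ψ : TestSpace,
        ‖dilate f x₀ ε ψ‖ ≤ C * (ε ^ α * L ε) * supSeminorm N (ψ : 𝓢(ℝ, ℂ)) := by
  obtain ⟨A, hA, hpos⟩ := hL.exists_forall_pos
  by_contra! hcon
  have hstep : ∀ k : ℕ, ∃ ε, 0 < ε ∧ ε ≤ min A (1 / ((k : ℝ) + 1)) ∧ ∃ ψ : TestSpace,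
      k * (ε ^ α * L ε) * supSeminorm k (ψ : 𝓢(ℝ, ℂ)) < ‖dilate f x₀ ε ψ‖ := by
    intro k
    obtain ⟨ε, h0, h1, h2⟩ := hcon (min A (1 / ((k : ℝ) + 1))) (lt_min hA (by positivity)) k k
      (Nat.cast_nonneg k)
    exact ⟨ε, h0, h1, h2 (hpos ε h0 (h1.trans (min_le_left _ _)))⟩
  choose ε h0 h1 ψ hψ using hstep
  have hlim : Tendsto ε atTop (𝓝[>] 0) := by
    refine tendsto_nhdsWithin_iff.2 ⟨?_, Eventually.of_forall h0⟩
    exact squeeze_zero (fun k => (h0 k).le) (fun k => (h1 k).trans (min_le_right _ _))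
      tendsto_one_div_add_atTop_nhds_zero_nat
  have hw : ∀ k, 0 < ε k ^ α * L (ε k) := fun k =>
    mul_pos (Real.rpow_pos_of_pos (h0 k) α) (hpos _ (h0 k) ((h1 k).trans (min_le_left _ _)))
  obtain ⟨N, C, hC, hNC⟩ := exists_forall_norm_apply_le_supSeminorm
    (fun k => ((ε k ^ α * L (ε k) : ℝ) : ℂ)⁻¹ • dilate f x₀ (ε k)) (fun η => by
      have := ((h η).comp hlim).norm.bddAbove_range
      refine this.mono ?_
      rintro _ ⟨k, rfl⟩
      refine ⟨k, ?_⟩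
      simp only [Function.comp_apply, smul_apply, smul_eq_mul, div_eq_inv_mul])
  obtain ⟨k, hk⟩ := exists_nat_ge (max C N)
  have hkN : N ≤ k := by exact_mod_cast (le_max_right _ _).trans hk
  have h2 := hNC k (ψ k)
  rw [smul_apply, smul_eq_mul, norm_mul, norm_inv, Complex.norm_real,
    Real.norm_of_nonneg (hw k).le, inv_mul_le_iff₀ (hw k)] at h2
  have h3 : C * supSeminorm N (ψ k : 𝓢(ℝ, ℂ)) ≤ k * supSeminorm k (ψ k : 𝓢(ℝ, ℂ)) :=
    mul_le_mul ((le_max_left _ _).trans hk) (supSeminorm_mono hkN _) (apply_nonneg _ _)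
      (Nat.cast_nonneg k)
  have h4 := (hψ k).trans_le (h2.trans (mul_le_mul_of_nonneg_left h3 (hw k).le))
  exact lt_irrefl _ (h4.trans_eq (by ring))

theorem exists_norm_dilate_le_of_mem_Icc (f : Distrib) (x₀ δ : ℝ) (hδ : 0 < δ) :
    ∃ (N : ℕ) (C : ℝ), 0 ≤ C ∧ ∀ ε, δ ≤ ε → ε ≤ 1 → ∀ ψ : TestSpace,
      ‖dilate f x₀ ε ψ‖ ≤ C * supSeminorm N (ψ : 𝓢(ℝ, ℂ)) := by
  obtain ⟨N, C, hC, h⟩ := exists_norm_apply_le_supSeminorm f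
  refine ⟨N, δ⁻¹ * (C * (2 * (δ⁻¹ + 1) ^ 2 * (1 + |x₀| * δ⁻¹)) ^ N), by positivity,
    fun ε h1 h2 ψ => ?_⟩
  have hε : 0 < ε := hδ.trans_le h1
  have hi : ε⁻¹ ≤ δ⁻¹ := inv_anti₀ hδ h1
  rw [dilate, dif_pos hε, smul_apply, smul_eq_mul, norm_mul, Complex.norm_real,
    Real.norm_of_nonneg (inv_pos.2 hε).le, mul_assoc, mul_assoc]
  have h3 := supSeminorm_schwartzAffine_le N ε⁻¹ (-x₀ / ε) (inv_pos.2 hε) (ψ : 𝓢(ℝ, ℂ))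
  rw [inv_inv, abs_div, abs_neg, abs_of_pos hε, div_eq_mul_inv |x₀|] at h3
  have hq : 0 ≤ supSeminorm N (ψ : 𝓢(ℝ, ℂ)) := apply_nonneg _ _
  have hi0 : 0 < ε⁻¹ := inv_pos.2 hε
  refine mul_le_mul hi ((h _).trans (mul_le_mul_of_nonneg_left (h3.trans ?_) hC)) (norm_nonneg _)
    (by positivity)
  gcongr

/-! ### From coefficients to quasiasymptotics. -/

theorem quasiasymptotics_of_coeff {φ : TestSpace} (hφ : IsOrthonormalWavelet (φ : 𝓢(ℝ, ℂ)))
    {L : ℝ → ℝ} (hL : SlowlyVaryingAtZero L) {f : Distrib} {x₀ α ε₀ : ℝ} (hε₀ : 0 < ε₀)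
    (hlim : CoeffLimitsExist φ f x₀ α L) (hbd : CoeffBound φ f x₀ α L ε₀) :
    ∃ g : Distrib, HasQuasiasymptotics f x₀ α L g := by
  obtain ⟨A, hA, hpos⟩ := hL.exists_forall_pos
  obtain ⟨β, γ, C, hβ, hγ, hC, hbd⟩ := hbd
  choose l hl using hlim
  let c : TestSpace → ℤ × ℤ → ℂ := fun ψ p =>
    ∫ x, (ψ : 𝓢(ℝ, ℂ)) x * (wavelet φ p.1 p.2 : 𝓢(ℝ, ℂ)) x
  have key : ∀ ψ : TestSpace, Tendsto
      (fun ε : ℝ => dilate f x₀ ε ψ / ((ε ^ α * L ε : ℝ) : ℂ)) (𝓝[>] 0)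
      (𝓝 (∑' p, c ψ p * l p.1 p.2)) := by
    intro ψ
    -- One integer exponent dominates both, since the bases `1 + |n|` and `2^m + 2^{-m}` are at
    -- least `1`; the majorant is then `summable_coeff_mul_weight`.
    obtain ⟨N, hN⟩ := exists_nat_ge (max β γ)
    have heq : ∀ ε : ℝ, dilate f x₀ ε ψ / ((ε ^ α * L ε : ℝ) : ℂ) =
        ∑' p : ℤ × ℤ, c ψ p * (waveletCoeff φ f ε x₀ p.1 p.2 / ((ε ^ α * L ε : ℝ) : ℂ)) := by
      intro ε
      have := (hasSum_apply_conj_wavelet hφ (dilate f x₀ ε) ψ).div_const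
        ((ε ^ α * L ε : ℝ) : ℂ)
      rw [← this.tsum_eq]
      exact tsum_congr fun p => mul_div_assoc _ _ _
    simp_rw [heq]
    refine tendsto_tsum_of_dominated_convergence
      ((summable_coeff_mul_weight N ψ φ).mul_left C)
      (fun p => (hl p.1 p.2).const_mul _) ?_
    filter_upwards [Ioc_mem_nhdsGT (lt_min hA hε₀)] with ε hε p
    have hw : 0 < ε ^ α * L ε :=
      mul_pos (Real.rpow_pos_of_pos hε.1 α) (hpos _ hε.1 (hε.2.trans (min_le_left _ _)))
    have h1 := hbd p.1 p.2 ε hε.1 (hε.2.trans (min_le_right _ _))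
    rw [norm_mul, norm_div, Complex.norm_real, Real.norm_of_nonneg hw.le, mul_left_comm C]
    refine mul_le_mul_of_nonneg_left ?_ (norm_nonneg _)
    rw [div_le_iff₀ hw]
    refine h1.trans ?_
    rw [one_div]
    have hn : (1 : ℝ) ≤ 1 + |(p.2 : ℝ)| := by linarith [abs_nonneg (p.2 : ℝ)]
    have hm := one_le_add_inv (show (0 : ℝ) < 2 ^ p.1 by positivity)
    have e1 : (1 + |(p.2 : ℝ)|) ^ β ≤ (1 + |(p.2 : ℝ)|) ^ N := by
      rw [← Real.rpow_natCast]
      exact Real.rpow_le_rpow_of_exponent_le hn ((le_max_left _ _).trans hN)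
    have e2 : ((2 : ℝ) ^ p.1 + ((2 : ℝ) ^ p.1)⁻¹) ^ γ ≤
        ((2 : ℝ) ^ p.1 + ((2 : ℝ) ^ p.1)⁻¹) ^ N := by
      rw [← Real.rpow_natCast]
      exact Real.rpow_le_rpow_of_exponent_le hm ((le_max_right _ _).trans hN)
    calc C * ε ^ α * L ε * (1 + |(p.2 : ℝ)|) ^ β * ((2 : ℝ) ^ p.1 + ((2 : ℝ) ^ p.1)⁻¹) ^ γ
        = C * ((1 + |(p.2 : ℝ)|) ^ β * ((2 : ℝ) ^ p.1 + ((2 : ℝ) ^ p.1)⁻¹) ^ γ) *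
          (ε ^ α * L ε) := by ring
      _ ≤ _ := by gcongr
  -- The pointwise limit of continuous functionals on a Baire space is continuous, so the series
  -- defines an element of `𝒮₀'(ℝ)`.
  refine ⟨continuousLinearMapOfTendsto (l := 𝓝[>] (0 : ℝ))
    (fun ε : ℝ => ((ε ^ α * L ε : ℝ) : ℂ)⁻¹ • dilate f x₀ ε)
    (f := fun ψ => ∑' p, c ψ p * l p.1 p.2) ?_, key⟩
  refine tendsto_pi_nhds.2 fun ψ => (key ψ).congr fun ε => ?_
  rw [smul_apply, smul_eq_mul, div_eq_inv_mul]

end Lizorkin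

end

/-! ### The two equivalences. -/

theorem theorem5p1 (φ : Lizorkin.TestSpace)
    (hφ : Lizorkin.IsOrthonormalWavelet (φ : 𝓢(ℝ, ℂ)))
    (L : ℝ → ℝ) (hL : Lizorkin.SlowlyVaryingAtZero L)
    (f : Lizorkin.Distrib) (x₀ α : ℝ) :
    ((∃ g : Lizorkin.Distrib, Lizorkin.HasQuasiasymptotics f x₀ α L g) ↔
      (Lizorkin.CoeffLimitsExist φ f x₀ α L ∧
        ∃ ε₀ : ℝ, 0 < ε₀ ∧ Lizorkin.CoeffBound φ f x₀ α L ε₀)) ∧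
    ((∀ δ : ℝ, 0 < δ → δ ≤ 1 → ∃ c : ℝ, 0 < c ∧ ∀ ε : ℝ, δ ≤ ε → ε ≤ 1 → c ≤ L ε) →
      ((∃ g : Lizorkin.Distrib, Lizorkin.HasQuasiasymptotics f x₀ α L g) ↔
        (Lizorkin.CoeffLimitsExist φ f x₀ α L ∧ Lizorkin.CoeffBound φ f x₀ α L 1))) := by
  refine ⟨⟨fun ⟨g, hg⟩ => ⟨fun m n => ⟨_, hg _⟩, ?_⟩, fun ⟨h1, ε₀, hε₀, h2⟩ =>
    Lizorkin.quasiasymptotics_of_coeff hφ hL hε₀ h1 h2⟩, fun hlow =>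
    ⟨fun ⟨g, hg⟩ => ⟨fun m n => ⟨_, hg _⟩, ?_⟩, fun ⟨h1, h2⟩ =>
    Lizorkin.quasiasymptotics_of_coeff hφ hL one_pos h1 h2⟩⟩
  · obtain ⟨ε₀, hε₀, N, C, hC, h⟩ := hg.exists_norm_dilate_le hL
    exact ⟨ε₀, hε₀, Lizorkin.coeffBound_of_norm_dilate_le φ f x₀ α L ε₀ N C hC
      (fun ε h0 h1 => (h ε h0 h1).1.le) fun ε h0 h1 => (h ε h0 h1).2⟩
  · obtain ⟨ε₀, hε₀, N₁, C₁, hC₁, h₁⟩ := hg.exists_norm_dilate_le hL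
    set δ := min ε₀ 1 with hδ_def
    have hδ : 0 < δ := lt_min hε₀ one_pos
    have hδ1 : δ ≤ 1 := min_le_right _ _
    obtain ⟨N₂, C₂, hC₂, h₂⟩ := Lizorkin.exists_norm_dilate_le_of_mem_Icc f x₀ δ hδ
    obtain ⟨c, hc, hcL⟩ := hlow δ hδ hδ1
    -- A lower bound for `ε^α L(ε)` on `[δ, 1]`; the exponent `|α|` serves both signs of `α`.
    -- Dividing `C₂` by it converts the constant bound there into one proportional to `ε^α L(ε)`.
    have hk : 0 < δ ^ |α| * c := mul_pos (Real.rpow_pos_of_pos hδ _) hc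
    have hLpos : ∀ ε, 0 < ε → ε ≤ 1 → 0 < L ε := fun ε h0 h1 =>
      let ⟨c', hc', h'⟩ := hlow ε h0 h1
      hc'.trans_le (h' ε le_rfl h1)
    refine Lizorkin.coeffBound_of_norm_dilate_le φ f x₀ α L 1 (max N₁ N₂)
      (C₁ + C₂ / (δ ^ |α| * c)) (by positivity) (fun ε h0 h1 => (hLpos ε h0 h1).le)
      fun ε h0 h1 ψ => ?_
    have hw : 0 ≤ ε ^ α * L ε :=
      mul_nonneg (Real.rpow_nonneg h0.le _) (hLpos ε h0 h1).le
    have hq : 0 ≤ Lizorkin.supSeminorm (max N₁ N₂) (ψ : 𝓢(ℝ, ℂ)) := apply_nonneg _ _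
    rcases le_total ε δ with hle | hle
    · refine ((h₁ ε h0 (hle.trans (min_le_left _ _))).2 ψ).trans ?_
      refine mul_le_mul ?_ (Lizorkin.supSeminorm_mono (le_max_left _ _) _) (apply_nonneg _ _)
        (by positivity)
      exact mul_le_mul_of_nonneg_right (le_add_of_nonneg_right (by positivity)) hw
    · refine (h₂ ε hle h1 ψ).trans ?_
      refine mul_le_mul ?_ (Lizorkin.supSeminorm_mono (le_max_right _ _) _) (apply_nonneg _ _)
        (by positivity)
      have hlow' : δ ^ |α| * c ≤ ε ^ α * L ε := by
        refine mul_le_mul ?_ (hcL ε hle h1) hc.le (Real.rpow_nonneg h0.le _)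
        exact (Real.rpow_le_rpow hδ.le hle (abs_nonneg α)).trans
          (Real.rpow_le_rpow_of_exponent_ge h0 h1 (le_abs_self α))
      calc C₂ = C₂ / (δ ^ |α| * c) * (δ ^ |α| * c) := (div_mul_cancel₀ _ hk.ne').symm
        _ ≤ (C₁ + C₂ / (δ ^ |α| * c)) * (ε ^ α * L ε) :=
          mul_le_mul (le_add_of_nonneg_left hC₁) hlow' hk.le (by positivity)
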